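/- A cut-and-project scheme $(G,H,\mathcal L)$ consists of locally compact abelian (Hausdorff) groups $G,H$ and a discrete cocompact subgroup $\mathcal L\subseteq G\times H$ such that the coordinate projection $\pi^G$ is injective on $\mathcal L$ and $\pi^H(\mathcal L)$ is dense in $H$. For $W\subseteq H$ put $\Lambda_W=\pi^G(\mathcal L\cap(G\times W))$. A subset of $G$ is called - a *model set* if it equals $\Lambda_W$ for some cut-and-project scheme $(G,H,\mathcal L)$ and some relatively compact Borel set $W\subseteq H$ with non-empty interior, and a *regular model set* if moreover $W$ can be chosen such that $\partial W$ has zero Haar measure; - an *inter model set* if it lies between $\Lambda_{W^\circ}$ and $\Lambda_{\overline W}$ (with respect to inclusion) for some cut-and-project scheme $(G,H,\mathcal L)$ and some relatively compact Borel set $W\subseteq H$ with non-empty interior, and an *inter regular model set* if moreover $W$ can be chosen such that $\partial W$ has zero Haar measure; - an *almost model set* if it lies between $\Lambda_U$ and $\Lambda_W$ for some cut-and-project scheme $(G,H,\mathcal L)$, some non-empty open $U\subseteq H$ and some compact $W\supseteq U$, and an *almost regular model set* if moreover $U,W$ can be chosen such that $W\setminus U$ has zero Haar measure. A point set in $G$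 is a locally finite subset of $G$; it is identified with its Dirac comb $\sum_{x\in\Lambda}\delta_x$. The hull $\mathbb X(\Lambda)$ of a point set $\Lambda$ is the set of all point sets $\Gamma\subseteq G$ in the closure of $\{s+\Lambda : s\in G\}$ with respect to the vague topology. **Proposition.** Let $G$ be a locally compact abelian group, let $\Lambda\subseteq G$ be a point set and let $\Gamma\in\mathbb X(\Lambda)$. (a) If $\Lambda$ is a model set, then $\Gamma$ is a model set; if $\Lambda$ is a regular model set, then $\Gamma$ is a regular model set. (b) If $\Lambda$ is an inter model set, then $\Gamma$ is an inter model set; if $\Lambda$ is an inter regular model set, then $\Gamma$ is an inter regular model set. (c) If $\Lambda$ is an almost model set, then $\Gamma$ is an almost model set; if $\Lambda$ is an almost regular model set, then $\Gamma$ is an almost regular model set. -/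

import Mathlib

universe u

open Set Topology MeasureTheory

/-- A cut-and-project scheme `(G, H, 𝓛)` over the locally compact abelian group `G`: the internal
space `H` is a locally compact abelian (Hausdorff) group, carrying its Borel `σ`-algebra, and `𝓛` is
a discrete cocompact subgroup of `G × H` that projects injectively to `G` and densely to `H`. -/
structure CutAndProjectScheme (G : Type u) [AddCommGroup G] [TopologicalSpace G] where
  /-- the internal space -/
  H : Type u
  [instAddCommGroup : AddCommGroup H]
  [instTopologicalSpace : TopologicalSpace H]
  [instIsTopologicalAddGroup : IsTopologicalAddGroup H]
  [instLocallyCompactSpace : LocallyCompactSpace H]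
  [instT2Space : T2Space H]
  [instMeasurableSpace : MeasurableSpace H]
  [instBorelSpace : BorelSpace H]
  /-- the lattice -/
  lattice : AddSubgroup (G × H)
  discrete : DiscreteTopology lattice
  cocompact : CompactSpace ((G × H) ⧸ lattice)
  injOn_fst : InjOn Prod.fst (lattice : Set (G × H))
  dense_snd : Dense (Prod.snd '' (lattice : Set (G × H)))

namespace CutAndProjectScheme

attribute [instance] instAddCommGroup instTopologicalSpace instIsTopologicalAddGroup
  instLocallyCompactSpace instT2Space instMeasurableSpace instBorelSpace

variable {G : Type u} [AddCommGroup G] [TopologicalSpace G]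

/-- The projection set `Λ_W = π^G (𝓛 ∩ (G × W))`. -/
def projectionSet (S : CutAndProjectScheme G) (W : Set S.H) : Set G :=
  Prod.fst '' ((S.lattice : Set (G × S.H)) ∩ univ ×ˢ W)

/-- The windows of model sets: relatively compact Borel sets with non-empty interior. -/
structure IsModelWindow (S : CutAndProjectScheme G) (W : Set S.H) : Prop where
  isCompact_closure : IsCompact (closure W)
  measurableSet : MeasurableSet W
  nonempty_interior : (interior W).Nonempty

/-- The windows of regular model sets: the topological boundary is moreover a Haar null set. -/
structure IsRegularModelWindow (S : CutAndProjectScheme G) (W : Set S.H) : Prop extends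
    S.IsModelWindow W where
  haar_frontier : (Measure.addHaar : Measure S.H) (frontier W) = 0

end CutAndProjectScheme

section ModelSets

variable {G : Type u} [AddCommGroup G] [TopologicalSpace G]

/-- `Γ` is a model set (in some cut-and-project scheme over `G`). -/
def IsModelSet (Γ : Set G) : Prop :=
  ∃ (S : CutAndProjectScheme G) (W : Set S.H), S.IsModelWindow W ∧ Γ = S.projectionSet W

/-- `Γ` is a regular model set. -/
def IsRegularModelSet (Γ : Set G) : Prop :=
  ∃ (S : CutAndProjectScheme G) (W : Set S.H), S.IsRegularModelWindow W ∧ Γ = S.projectionSet W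

/-- `Γ` is an inter model set. -/
def IsInterModelSet (Γ : Set G) : Prop :=
  ∃ (S : CutAndProjectScheme G) (W : Set S.H), S.IsModelWindow W ∧
    S.projectionSet (interior W) ⊆ Γ ∧ Γ ⊆ S.projectionSet (closure W)

/-- `Γ` is an inter regular model set. -/
def IsInterRegularModelSet (Γ : Set G) : Prop :=
  ∃ (S : CutAndProjectScheme G) (W : Set S.H), S.IsRegularModelWindow W ∧
    S.projectionSet (interior W) ⊆ Γ ∧ Γ ⊆ S.projectionSet (closure W)

/-- `Γ` is an almost model set. -/
def IsAlmostModelSet (Γ : Set G) : Prop :=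
  ∃ (S : CutAndProjectScheme G) (U W : Set S.H), U ⊆ W ∧ IsOpen U ∧ U.Nonempty ∧ IsCompact W ∧
    S.projectionSet U ⊆ Γ ∧ Γ ⊆ S.projectionSet W

/-- `Γ` is an almost regular model set. -/
def IsAlmostRegularModelSet (Γ : Set G) : Prop :=
  ∃ (S : CutAndProjectScheme G) (U W : Set S.H), U ⊆ W ∧ IsOpen U ∧ U.Nonempty ∧ IsCompact W ∧
    (Measure.addHaar : Measure S.H) (W \ U) = 0 ∧
    S.projectionSet U ⊆ Γ ∧ Γ ⊆ S.projectionSet W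

end ModelSets

/-- A point set in `G`: a locally finite subset, so that its Dirac comb is a Radon measure. -/
structure PointSet (G : Type u) [TopologicalSpace G] where
  /-- the underlying set -/
  carrier : Set G
  locallyFinite : ∀ K : Set G, IsCompact K → (carrier ∩ K).Finite

namespace PointSet

variable {G : Type u} [TopologicalSpace G]

/-- The Dirac comb `∑_{x ∈ Λ} δ_x` of a point set, as a functional on `C_c(G)`; for each `f` only
finitely many summands are non-zero. -/
noncomputable def diracComb (Λ : PointSet G) (f : CompactlySupportedContinuousMap G ℝ) : ℝ :=
  ∑ᶠ x ∈ Λ.carrier, f x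

/-- The vague topology: the coarsest topology on point sets for which all evaluations
`Λ ↦ ∑_{x ∈ Λ} f x` with `f ∈ C_c(G)` are continuous. -/
noncomputable instance vagueTopology : TopologicalSpace (PointSet G) :=
  TopologicalSpace.induced diracComb Pi.topologicalSpace

/-- The translate `s + Λ`. -/
def translate [AddCommGroup G] [IsTopologicalAddGroup G] (s : G) (Λ : PointSet G) :
    PointSet G where
  carrier := (fun x => s + x) '' Λ.carrier
  locallyFinite K hK := by
    refine ((Λ.locallyFinite ((fun x => -s + x) '' K)
      (hK.image (continuous_const_add (-s)))).image (fun x => s + x)).subset ?_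
    rintro _ ⟨⟨x, hx, rfl⟩, hK⟩
    exact ⟨x, ⟨hx, s + x, hK, by simp⟩, rfl⟩

/-- The hull `𝕏(Λ)`: the closure of the translation orbit of `Λ` in the vague topology. -/
def hull [AddCommGroup G] [IsTopologicalAddGroup G] (Λ : PointSet G) : Set (PointSet G) :=
  closure (range fun s : G => translate s Λ)

end PointSet

/-!
Each of the six properties of `Γ` provides *brackets*: `Γ` lies between the projection sets of a
non-empty open window `U` and a compact window `W ⊇ U`, and in the regular cases `W \ U` is null.

*Passage to the hull.* Translating `Λ` replaces the lattice `𝓛` by a coset `p + 𝓛`. Being bracketed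
by `U` and `W` for the coset `p + 𝓛` is a closed condition on the pair of the point set and `p`, and
`p` ranges over a compact set modulo `𝓛`, so every element of the hull is bracketed for some coset.
Adjoining `p` to the lattice, with internal space a quotient of `H × ℤ`, turns that coset into
lattice points whose internal coordinates lie in a translate of an open copy of `H`, to which the
windows are moved.

*From brackets to windows.* An abelian group embeds into a direct sum of copies of a countable
divisible subgroup of the circle, hence maps to a power of the circle in such a way that each of its
subsets is the preimage of a Borel set. Pairing the star map with such a map `φ : 𝓛 → K` keeps all
axioms of a cut-and-project scheme, because `K` is compact, and lets a Borel set `B ⊆ K` decide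
which lattice points over `W \ U` belong to the window `U ∪ (W ∩ B)`, whose boundary lies over
`W \ U`. Thus almost (regular) model sets are already (regular) model sets.
-/

section Independent

variable {α : Type*} [CompleteLattice α] [IsModularLattice α]

theorem sSupIndep_insert {s : Set α} {a : α} (hs : sSupIndep s) (ha : Disjoint a (sSup s)) :
    sSupIndep (insert a s) := by
  rintro b (rfl | hb)
  · rw [insert_sdiff_of_mem _ (mem_singleton b)]
    exact ha.mono_right (sSup_le_sSup sdiff_subset)
  · have hsup : sSup (s \ {b}) ⊔ b = sSup s := by
      rw [sup_comm, ← sSup_insert, insert_sdiff_singleton, insert_eq_of_mem hb]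
    have hdisj : Disjoint b (a ⊔ sSup (s \ {b})) := by
      rw [sup_comm]
      refine (hs hb).disjoint_sup_right_of_disjoint_sup_left (b := sSup (s \ {b})) ?_
      rw [sup_comm, hsup]
      exact ha.symm
    refine hdisj.mono_right ?_
    rw [← sSup_insert]
    refine sSup_le_sSup ?_
    rintro c ⟨rfl | hc, hcb⟩
    · exact mem_insert c _
    · exact mem_insert_of_mem a ⟨hc, hcb⟩

theorem exists_sSupIndep_forall_disjoint_imp_eq_bot [IsCompactlyGenerated α] (P : Set α) :
    ∃ s ⊆ P, sSupIndep s ∧ ∀ a ∈ P, Disjoint a (sSup s) → a = ⊥ := by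
  obtain ⟨s, hs⟩ := zorn_subset {s : Set α | s ⊆ P ∧ sSupIndep s} fun c hc hchain =>
    ⟨⋃₀ c, ⟨sUnion_subset fun t ht => (hc ht).1,
      iSupIndep_sUnion_of_directed hchain.directedOn fun t ht => (hc ht).2⟩,
      fun _ => subset_sUnion_of_mem⟩
  refine ⟨s, hs.prop.1, hs.prop.2, fun a ha hdisj => ?_⟩
  have hmem : a ∈ s := hs.le_of_ge ⟨insert_subset ha hs.prop.1, sSupIndep_insert hs.prop.2 hdisj⟩
    (subset_insert a s) (mem_insert a s)
  exact disjoint_self.1 (hdisj.mono_right (le_sSup hmem))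

end Independent

section Embedding

variable {R M Q : Type*} [Ring R] [AddCommGroup M] [Module R M] [AddCommGroup Q] [Module R Q]

theorem injective_of_injective_comp_of_essential {P : Type*} [AddCommGroup P] [Module R P]
    {p : P →ₗ[R] M} (hp : ∀ x : M, Disjoint (Submodule.span R {x}) p.range → x = 0)
    {f : M →ₗ[R] Q} (hf : Function.Injective (f ∘ₗ p)) : Function.Injective f := by
  refine (injective_iff_map_eq_zero f).2 fun x hx => hp x (Submodule.disjoint_def.2 ?_)
  rintro _ hyx ⟨y, rfl⟩
  obtain ⟨r, hr⟩ := Submodule.mem_span_singleton.1 hyx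
  have hy : (f ∘ₗ p) y = 0 := by simp [← hr, hx]
  rw [(injective_iff_map_eq_zero _).1 hf y hy, map_zero]

theorem exists_injective_span_singleton {x : M} {c : Q}
    (h : Ideal.torsionOf R M x = Ideal.torsionOf R Q c) :
    ∃ f : Submodule.span R {x} →ₗ[R] Q, Function.Injective f :=
  ⟨(Submodule.span R {c}).subtype ∘ₗ ((Ideal.quotTorsionOfEquivSpanSingleton R M x).symm ≪≫ₗ
      Submodule.quotEquivOfEq _ _ h ≪≫ₗ Ideal.quotTorsionOfEquivSpanSingleton R Q c).toLinearMap,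
    (Submodule.injective_subtype _).comp (LinearEquiv.injective _)⟩

theorem exists_injective_linearMap_finsupp {M : Type u} [AddCommGroup M] [Module R M]
    (hQ : ∀ E : Type u, Module.Baer R (E →₀ Q))
    (htors : ∀ x : M, ∃ c : Q, Ideal.torsionOf R M x = Ideal.torsionOf R Q c) :
    ∃ (E : Type u) (f : M →ₗ[R] (E →₀ Q)), Function.Injective f := by
  classical
  obtain ⟨s, hsP, hs, hess⟩ := exists_sSupIndep_forall_disjoint_imp_eq_bot
    (range fun x : M => Submodule.span R {x})
  rw [sSupIndep_iff] at hs
  have hcyclic : ∀ N : s, ∃ g : N.1 →ₗ[R] Q, Function.Injective g := by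
    rintro ⟨N, hN⟩
    obtain ⟨x, rfl⟩ := hsP hN
    obtain ⟨c, hc⟩ := htors x
    exact exists_injective_span_singleton hc
  choose g hg using hcyclic
  let p : (Π₀ N : s, N.1) →ₗ[R] M := DFinsupp.lsum ℕ fun N => N.1.subtype
  let q : (Π₀ N : s, N.1) →ₗ[R] (s →₀ Q) :=
    (finsuppLequivDFinsupp R).symm.toLinearMap ∘ₗ DFinsupp.mapRange.linearMap g
  have hq : Function.Injective q :=
    (finsuppLequivDFinsupp R).symm.injective.comp
      ((DFinsupp.mapRange_injective _ fun N => map_zero (g N)).2 hg)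
  obtain ⟨f, hf⟩ := (hQ s).extension_property p hs.dfinsupp_lsum_injective q
  refine ⟨s, f, injective_of_injective_comp_of_essential (p := p) (fun x hx => ?_) (hf ▸ hq)⟩
  have hrange : p.range = sSup s := by
    rw [sSup_eq_iSup', Submodule.iSup_eq_range_dfinsupp_lsum]
  exact Submodule.span_singleton_eq_bot.1 (hess _ (mem_range_self x) (hrange ▸ hx))

end Embedding

section Circle

theorem exists_countable_divisible_addSubgroup_unitAddCircle :
    ∃ C : AddSubgroup UnitAddCircle, Countable C ∧
      (∀ n : ℤ, n ≠ 0 → Function.Surjective (n • · : C → C)) ∧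
      ∀ n : ℕ, ∃ c : C, addOrderOf c = n := by
  let φ : ℚ × ℚ →+ UnitAddCircle := (QuotientAddGroup.mk' _).comp
    { toFun := fun c => (c.1 + c.2 * √2 : ℝ)
      map_zero' := by simp
      map_add' := fun c d => by push_cast [Prod.fst_add, Prod.snd_add]; ring }
  have horder : ∀ c, addOrderOf (φ.rangeRestrict c) = addOrderOf (φ c) := fun c =>
    (addOrderOf_injective _ (AddSubgroup.subtype_injective φ.range) (φ.rangeRestrict c)).symm
  refine ⟨φ.range, φ.rangeRestrict_surjective.countable, fun n hn => ?_, fun n => ?_⟩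
  · let := φ.rangeRestrict_surjective.divisibleBy φ.rangeRestrict fun c (n : ℤ) =>
      map_zsmul φ.rangeRestrict n c
    exact DivisibleBy.surjective_smul _ _ hn
  rcases n.eq_zero_or_pos with rfl | hn
  · refine ⟨φ.rangeRestrict (0, 1), ?_⟩
    have : φ (0, 1) = ((√2 : ℝ) : UnitAddCircle) := by simp [φ]
    rw [horder, this, ← AddCircle.denseRange_zsmul_iff, AddCircle.denseRange_zsmul_coe_iff]
    simpa using irrational_sqrt_two
  · refine ⟨φ.rangeRestrict (1 / n, 0), ?_⟩
    have : φ (1 / n, 0) = ((1 / n : ℝ) : UnitAddCircle) := by simp [φ]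
    rw [horder, this, AddCircle.addOrderOf_period_div hn]

theorem baer_finsupp_of_surjective_zsmul {C : Type*} [AddCommGroup C]
    (hC : ∀ n : ℤ, n ≠ 0 → Function.Surjective (n • · : C → C)) (E : Type*) :
    Module.Baer ℤ (E →₀ C) := by
  let : DivisibleBy (E →₀ C) ℤ := divisibleByOfSMulRightSurj _ _ fun {n} hn =>
    Finsupp.mapRange_surjective _ (smul_zero n) (hC n hn)
  exact Module.Baer.of_divisible _

theorem torsionOf_int_eq_of_addOrderOf_eq {L C : Type*} [AddCommGroup L] [AddCommGroup C]
    {x : L} {c : C} (h : addOrderOf x = addOrderOf c) :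
    Ideal.torsionOf ℤ L x = Ideal.torsionOf ℤ C c := by
  ext n
  rw [Ideal.mem_torsionOf_iff, Ideal.mem_torsionOf_iff, ← addOrderOf_dvd_iff_zsmul_eq_zero, h,
    addOrderOf_dvd_iff_zsmul_eq_zero]

end Circle

section BorelTrace

/-- The points of rank `n` are isolated by the sets `O` among the points of rank at most `n`, so one
open set minus another selects those lying in `A`. -/
theorem exists_borel_preimage_eq_of_rank {L K : Type*} [TopologicalSpace K] (ι : L → K)
    (r : L → ℕ) (h : ∀ x, ∃ O : Set K, IsOpen O ∧ ι x ∈ O ∧ ∀ y, ι y ∈ O → r y ≤ r x → y = x)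
    (A : Set L) : ∃ B : Set K, MeasurableSet[borel K] B ∧ ι ⁻¹' B = A := by
  choose O hO hxO hiso using h
  borelize K
  refine ⟨⋃ n, (⋃ x ∈ {x | x ∈ A ∧ r x = n}, O x) \ ⋃ x ∈ {x | n < r x}, O x,
    MeasurableSet.iUnion fun n => ?_, ?_⟩
  · exact (isOpen_biUnion fun x _ => hO x).measurableSet.diff
      (isOpen_biUnion fun x _ => hO x).measurableSet
  · ext y
    simp only [mem_preimage, mem_iUnion, mem_sdiff, mem_ofPred_eq, exists_prop, not_exists, not_and]
    constructor
    · rintro ⟨n, ⟨x, ⟨hxA, rfl⟩, hy⟩, hn⟩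
      have hle : r y ≤ r x := not_lt.1 fun hlt => hn y hlt (hxO y)
      exact hiso x y hy hle ▸ hxA
    · intro hy
      refine ⟨r y, ⟨y, ⟨hy, rfl⟩, hxO y⟩, fun x hx hyx => ?_⟩
      have := hiso x y hyx hx.le
      subst this
      exact lt_irrefl _ hx

theorem finsupp_eq_of_le_of_degree_le {E : Type*} {m n : E →₀ ℕ} (hle : m ≤ n)
    (hdeg : n.degree ≤ m.degree) : m = n := by
  have hsub : (n - m).degree = 0 := by
    have := congrArg Finsupp.degree (tsub_add_cancel_of_le hle)
    rw [map_add] at this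
    omega
  exact hle.antisymm (tsub_eq_zero_iff_le.1 ((Finsupp.degree_eq_zero_iff _).1 hsub))

theorem exists_injective_nat_zero_eq (C : Type*) [Zero C] [Countable C] :
    ∃ enc : C → ℕ, Function.Injective enc ∧ enc 0 = 0 := by
  obtain ⟨enc, henc⟩ := exists_injective_nat C
  exact ⟨Equiv.swap (enc 0) 0 ∘ enc, (Equiv.injective _).comp henc, Equiv.swap_apply_left _ _⟩

theorem exists_borel_preimage_finsupp_eq {E C T : Type*} [Zero C] [Countable C]
    [TopologicalSpace T] [T1Space T] {ι : C → T} (hι : Function.Injective ι) (A : Set (E →₀ C)) :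
    ∃ B : Set (E → T), MeasurableSet[borel (E → T)] B ∧ (fun x e => ι (x e)) ⁻¹' B = A := by
  obtain ⟨enc, henc, henc0⟩ := exists_injective_nat_zero_eq C
  let code : (E →₀ C) → (E →₀ ℕ) := Finsupp.mapRange enc henc0
  refine exists_borel_preimage_eq_of_rank _ (fun x => (code x).degree) (fun x => ?_) A
  let F : Set C := {c | enc c ≤ (code x).degree}
  have hF : F.Finite := (finite_Iic (code x).degree).preimage henc.injOn
  refine ⟨⋂ e ∈ x.support, ⋂ c ∈ F \ {x e}, {k | k e ≠ ι c}, ?_, ?_, fun y hy hdeg => ?_⟩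
  · exact isOpen_biInter_finset fun e _ => hF.sdiff.isOpen_biInter fun c _ =>
      isOpen_ne.preimage (continuous_apply e)
  · simp only [mem_iInter]
    exact fun e _ c hc h => hc.2 (hι h).symm
  simp only [mem_iInter] at hy
  have hyF : ∀ e, y e ∈ F := fun e => (Finsupp.le_degree e (code y)).trans hdeg
  have heq : ∀ e ∈ x.support, y e = x e := fun e he =>
    by_contra fun hne => hy e he (y e) ⟨hyF e, hne⟩ rfl
  have hle : code x ≤ code y := fun e => by
    by_cases he : e ∈ x.support
    · simp [code, heq e he]
    · simp [code, Finsupp.notMem_support_iff.1 he, henc0]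
  exact (Finsupp.mapRange_injective enc henc0 henc (finsupp_eq_of_le_of_degree_le hle hdeg)).symm

theorem exists_addMonoidHom_forall_exists_borel_preimage_eq (L : Type u) [AddCommGroup L] :
    ∃ (E : Type u) (φ : L →+ (E → UnitAddCircle)), ∀ A : Set L,
      ∃ B : Set (E → UnitAddCircle), MeasurableSet[borel _] B ∧ φ ⁻¹' B = A := by
  obtain ⟨C, _, hdiv, horder⟩ := exists_countable_divisible_addSubgroup_unitAddCircle
  obtain ⟨E, f, hf⟩ := exists_injective_linearMap_finsupp (R := ℤ) (M := L) (Q := C)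
    (baer_finsupp_of_surjective_zsmul hdiv) fun x =>
      (horder (addOrderOf x)).imp fun _ hc => torsionOf_int_eq_of_addOrderOf_eq hc.symm
  refine ⟨E, AddMonoidHom.mk' (fun x e => (f x e : UnitAddCircle)) fun x y => by ext; simp,
    fun A => ?_⟩
  obtain ⟨B, hB, hBA⟩ := exists_borel_preimage_finsupp_eq (Subtype.val_injective (p := (· ∈ C)))
    (f '' A)
  refine ⟨B, hB, ?_⟩
  rw [← hf.preimage_image A, ← hBA]
  rfl

end BorelTrace

section Vague

variable {G : Type u} [TopologicalSpace G]

theorem exists_bump [LocallyCompactSpace G] [RegularSpace G] {x : G} {O : Set G} (hO : O ∈ 𝓝 x) :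
    ∃ φ : CompactlySupportedContinuousMap G ℝ, (∀ y, 0 ≤ φ y) ∧ (∀ᶠ y in 𝓝 x, φ y = 1) ∧
      ∀ y, φ y ≠ 0 → y ∈ O := by
  obtain ⟨k, hk, hkO, hkc⟩ := local_compact_nhds (interior_mem_nhds.2 hO)
  obtain ⟨f, hf1, hf0, hfc, hf⟩ := exists_continuous_one_zero_of_isCompact hkc
    (isOpen_interior (s := O)).isClosed_compl (disjoint_compl_right_iff_subset.2 hkO)
  refine ⟨⟨f, hfc⟩, fun y => (hf y).1, Filter.mem_of_superset hk hf1, fun y hy => ?_⟩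
  by_contra hyO
  exact hy (hf0 fun h => hyO (interior_subset h))

namespace PointSet

theorem one_le_diracComb (Λ : PointSet G) {φ : CompactlySupportedContinuousMap G ℝ}
    (hφ : ∀ y, 0 ≤ φ y) {x : G} (hx : x ∈ Λ.carrier) (hx1 : φ x = 1) : 1 ≤ Λ.diracComb φ := by
  have hfin : (Λ.carrier ∩ Function.support φ).Finite :=
    (Λ.locallyFinite _ φ.hasCompactSupport').subset
      (inter_subset_inter_right _ (subset_tsupport _))
  rw [diracComb, ← finsum_mem_inter_support, finsum_mem_eq_finite_toFinset_sum _ hfin, ← hx1]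
  exact Finset.single_le_sum (fun y _ => hφ y) (by simp [hx, hx1])

theorem continuous_diracComb (φ : CompactlySupportedContinuousMap G ℝ) :
    Continuous fun Λ : PointSet G => Λ.diracComb φ :=
  (continuous_apply φ).comp (continuous_induced_dom : Continuous (diracComb (G := G)))

variable [LocallyCompactSpace G] [T2Space G]

theorem isClosed_setOf_mem : IsClosed {p : PointSet G × G | p.2 ∈ p.1.carrier} := by
  refine isOpen_compl_iff.1 (isOpen_iff_mem_nhds.2 fun ⟨Γ, x⟩ hx => ?_)
  obtain ⟨k, hkc, hk⟩ := exists_compact_mem_nhds x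
  have hO : k ∩ (Γ.carrier ∩ k)ᶜ ∈ 𝓝 x :=
    Filter.inter_mem hk ((Γ.locallyFinite k hkc).isClosed.isOpen_compl.mem_nhds fun h => hx h.1)
  obtain ⟨φ, hφ, hφ1, hφO⟩ := exists_bump hO
  have hΓ : Γ.diracComb φ = 0 := finsum_mem_eq_zero_of_forall_eq_zero fun z hz =>
    by_contra fun hne => (hφO z hne).2 ⟨hz, (hφO z hne).1⟩
  have hlt : ∀ᶠ Λ in 𝓝 Γ, diracComb Λ φ < 1 :=
    (continuous_diracComb φ).continuousAt.eventually_lt_const (hΓ.trans_lt one_pos)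
  filter_upwards [hlt.prod_nhds hφ1] with p hp hmem
  exact hp.1.not_ge (p.1.one_le_diracComb hφ hmem hp.2)

theorem isOpen_setOf_inter_nonempty {O : Set G} (hO : IsOpen O) :
    IsOpen {Λ : PointSet G | (Λ.carrier ∩ O).Nonempty} := by
  refine isOpen_iff_mem_nhds.2 fun Γ ⟨x, hx, hxO⟩ => ?_
  obtain ⟨φ, hφ, hφ1, hφO⟩ := exists_bump (hO.mem_nhds hxO)
  have hpos : 0 < Γ.diracComb φ := one_pos.trans_le (Γ.one_le_diracComb hφ hx hφ1.self_of_nhds)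
  filter_upwards [(continuous_diracComb φ).continuousAt.eventually_const_lt hpos] with Λ hΛ
  obtain ⟨y, hy, hne⟩ := exists_ne_zero_of_finsum_mem_ne_zero hΛ.ne'
  exact ⟨y, hy, hφO y hne⟩

theorem isClosed_setOf_forall_mem {Y : Type*} [TopologicalSpace Y] {R : Set (G × Y)}
    (hR : IsClosed R) : IsClosed {p : PointSet G × Y | ∀ x ∈ p.1.carrier, (x, p.2) ∈ R} := by
  refine isOpen_compl_iff.1 (isOpen_iff_mem_nhds.2 fun ⟨Γ, y⟩ hΓ => ?_)
  obtain ⟨x, hx, hxy⟩ : ∃ x ∈ Γ.carrier, (x, y) ∉ R := by simpa using hΓ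
  obtain ⟨O, N, hO, hN, hxO, hyN, hON⟩ := isOpen_prod_iff.1 hR.isOpen_compl x y hxy
  have hopen := (isOpen_setOf_inter_nonempty hO).prod hN
  filter_upwards [hopen.mem_nhds ⟨⟨x, hx, hxO⟩, hyN⟩] with p hp hmem
  obtain ⟨⟨z, hz, hzO⟩, hpN⟩ := hp
  exact hON (mk_mem_prod hzO hpN) (hmem z hz)

end PointSet

end Vague

section LatticeQuotient

variable {X Y : Type*} [AddCommGroup X] [TopologicalSpace X] [AddCommGroup Y] [TopologicalSpace Y]

theorem exists_isCompact_forall_exists_add_mem [IsTopologicalAddGroup X] [LocallyCompactSpace X]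
    (N : AddSubgroup X) [CompactSpace (X ⧸ N)] :
    ∃ C : Set X, IsCompact C ∧ ∀ x, ∃ l ∈ N, x + l ∈ C := by
  choose k hkc hk using fun x : X => exists_compact_mem_nhds x
  obtain ⟨t, -, ht⟩ := (isCompact_univ (X := X ⧸ N)).elim_nhds_subcover
    (fun q => QuotientAddGroup.mk '' k q.out) fun q _ => by
      have := QuotientAddGroup.isOpenQuotientMap_mk.isOpenMap.image_mem_nhds (hk q.out)
        (f := (QuotientAddGroup.mk : X → X ⧸ N))
      rwa [QuotientAddGroup.out_eq'] at this
  refine ⟨⋃ q ∈ t, k q.out, t.isCompact_biUnion fun q _ => hkc _, fun x => ?_⟩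
  obtain ⟨q, hq, y, hy, hyx⟩ := by simpa using ht (mem_univ (x : X ⧸ N))
  rw [QuotientAddGroup.eq_iff_sub_mem] at hyx
  exact ⟨y - x, hyx, by simpa using ⟨q, hq, hy⟩⟩

theorem compactSpace_quotient_of_forall_exists_sub_mem {N : AddSubgroup X} {M : AddSubgroup Y}
    [CompactSpace (X ⧸ N)] {f : X →+ Y} (hf : Continuous f) (hNM : N ≤ M.comap f)
    (h : ∀ y, ∃ x, f x - y ∈ M) : CompactSpace (Y ⧸ M) := by
  have hcont : Continuous (QuotientAddGroup.map N M f hNM) :=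
    (QuotientAddGroup.continuous_mk.comp hf).quotient_lift _
  refine Function.Surjective.compactSpace hcont fun q => ?_
  obtain ⟨y, rfl⟩ := QuotientAddGroup.mk_surjective q
  obtain ⟨x, hx⟩ := h y
  exact ⟨x, QuotientAddGroup.eq_iff_sub_mem.2 hx⟩

theorem compactSpace_quotient_of_isProperMap [IsTopologicalAddGroup X] [LocallyCompactSpace X]
    {N : AddSubgroup X} {M : AddSubgroup Y} [CompactSpace (X ⧸ N)] {f : Y →+ X}
    (hf : IsProperMap f) (hNM : N ≤ M.map f) : CompactSpace (Y ⧸ M) := by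
  obtain ⟨C, hC, hCN⟩ := exists_isCompact_forall_exists_add_mem N
  refine ⟨((hf.isCompact_preimage hC).image QuotientAddGroup.continuous_mk).of_isClosed_subset
    isClosed_univ fun q _ => ?_⟩
  obtain ⟨y, rfl⟩ := QuotientAddGroup.mk_surjective q
  obtain ⟨_, hl, hlC⟩ := hCN (f y)
  obtain ⟨m, hm, rfl⟩ := hNM hl
  refine ⟨y + m, by rwa [mem_preimage, map_add], ?_⟩
  rwa [QuotientAddGroup.eq_iff_sub_mem, add_sub_cancel_left]

end LatticeQuotient

theorem discreteTopology_of_isOpenQuotientMap {X Y : Type*} [TopologicalSpace X]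
    [TopologicalSpace Y] {f : X → Y} (hf : IsOpenQuotientMap f) {s : Set Y}
    [DiscreteTopology (f ⁻¹' s)] : DiscreteTopology s := by
  have := hf.restrictPreimage s
  refine discreteTopology_iff_forall_isOpen.2 fun t => ?_
  rw [← this.isQuotientMap.isOpen_preimage]
  exact isOpen_discrete _

theorem measurableSet_preimage_borel {X Y : Type*} [TopologicalSpace X] [MeasurableSpace X]
    [BorelSpace X] [TopologicalSpace Y] {f : X → Y} (hf : Continuous f) {B : Set Y}
    (hB : MeasurableSet[borel Y] B) : MeasurableSet (f ⁻¹' B) := by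
  borelize Y
  exact hf.measurable hB

section Haar

variable {X Y : Type*} [AddCommGroup X] [TopologicalSpace X] [IsTopologicalAddGroup X]
  [MeasurableSpace X] [BorelSpace X] [AddCommGroup Y] [TopologicalSpace Y]
  [IsTopologicalAddGroup Y] [MeasurableSpace Y] [BorelSpace Y]
  {μ : Measure X} [μ.IsAddHaarMeasure] {ν : Measure Y} [ν.IsAddHaarMeasure]

theorem addHaar_image_eq_zero_of_isOpenEmbedding [LocallyCompactSpace X] {f : X →+ Y}
    (hf : IsOpenEmbedding f) {A : Set X} (hA : IsCompact A) (h0 : μ A = 0) : ν (f '' A) = 0 := by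
  have : (ν.comap f).IsAddHaarMeasure := .comap (mH := inferInstance) ν hf
  rw [← hf.measurableEmbedding.comap_apply,
    Measure.measure_isAddInvariant_eq_smul_of_isCompact_closure _ μ hA.closure, h0, smul_zero]

theorem addHaar_preimage_eq_zero_of_isProperMap [LocallyCompactSpace Y] [T2Space Y]
    {f : X →+ Y} (hf : IsProperMap f) (hsurj : Function.Surjective f) {A : Set Y}
    (hA : IsCompact A) (h0 : ν A = 0) : μ (f ⁻¹' A) = 0 := by
  have : (μ.map f).IsAddHaarMeasure := Measure.isAddHaarMeasure_map μ f hf.continuous hsurj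
    (isProperMap_iff_tendsto_cocompact.1 hf).2
  rw [← Measure.map_apply hf.continuous.measurable hA.isClosed.measurableSet,
    Measure.measure_isAddInvariant_eq_smul_of_isCompact_closure _ ν hA.closure, h0, smul_zero]

end Haar

namespace CutAndProjectScheme

section Projection

variable {G : Type u} [AddCommGroup G] [TopologicalSpace G]

theorem mem_projectionSet {S : CutAndProjectScheme G} {W : Set S.H} {x : G} :
    x ∈ S.projectionSet W ↔ ∃ h ∈ W, (x, h) ∈ S.lattice := by
  constructor
  · rintro ⟨⟨x, h⟩, ⟨hl, -, hW⟩, rfl⟩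
    exact ⟨h, hW, hl⟩
  · rintro ⟨h, hW, hl⟩
    exact ⟨(x, h), ⟨hl, mem_univ _, hW⟩, rfl⟩

theorem projectionSet_mono (S : CutAndProjectScheme G) {V W : Set S.H} (h : V ⊆ W) :
    S.projectionSet V ⊆ S.projectionSet W :=
  image_mono (inter_subset_inter_right _ (prod_mono_right h))

/-- The projection set of the window `W` for the coset `p + 𝓛` in place of `𝓛`. -/
def cosetProjectionSet (S : CutAndProjectScheme G) (p : G × S.H) (W : Set S.H) : Set G :=
  {x | ∃ h ∈ W, (x, h) - p ∈ S.lattice}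

theorem cosetProjectionSet_zero (S : CutAndProjectScheme G) (W : Set S.H) :
    S.cosetProjectionSet 0 W = S.projectionSet W := by
  ext x
  simp only [cosetProjectionSet, sub_zero, mem_ofPred_eq, mem_projectionSet]

theorem cosetProjectionSet_add_of_mem {S : CutAndProjectScheme G} {l : G × S.H}
    (hl : l ∈ S.lattice) (p : G × S.H) (W : Set S.H) :
    S.cosetProjectionSet (p + l) W = S.cosetProjectionSet p W := by
  ext x
  refine exists_congr fun h => and_congr_right fun _ => ?_
  rw [← sub_sub, sub_eq_add_neg, S.lattice.add_mem_cancel_right (S.lattice.neg_mem hl)]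

theorem image_add_cosetProjectionSet (S : CutAndProjectScheme G) (s : G) (p : G × S.H)
    (W : Set S.H) :
    (s + ·) '' S.cosetProjectionSet p W = S.cosetProjectionSet (p + (s, 0)) W := by
  rw [image_add_left]
  ext x
  refine exists_congr fun h => and_congr_right fun _ => ?_
  have hshift : (-s + x, h) = (x, h) - (s, 0) := by ext <;> simp [neg_add_eq_sub]
  rw [hshift, sub_right_comm, sub_sub]

variable [IsTopologicalAddGroup G] [T2Space G]

theorem isClosed_lattice (S : CutAndProjectScheme G) : IsClosed (S.lattice : Set (G × S.H)) :=
  have := S.discrete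
  AddSubgroup.isClosed_of_discrete

theorem isClosed_setOf_mem_cosetProjectionSet (S : CutAndProjectScheme G) {W : Set S.H}
    (hW : IsCompact W) : IsClosed {z : G × (G × S.H) | z.1 ∈ S.cosetProjectionSet z.2 W} := by
  have : CompactSpace W := isCompact_iff_compactSpace.1 hW
  have hclosed : IsClosed {z : (G × (G × S.H)) × W | (z.1.1, z.2.1) - z.1.2 ∈ S.lattice} :=
    S.isClosed_lattice.preimage (f := fun z : (G × (G × S.H)) × W => (z.1.1, z.2.1) - z.1.2)
      (by fun_prop)
  convert isClosedMap_fst_of_compactSpace _ hclosed using 1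
  ext ⟨x, p⟩
  simp [cosetProjectionSet]

theorem isClosed_setOf_cosetProjectionSet_subset [LocallyCompactSpace G]
    (S : CutAndProjectScheme G) {U : Set S.H} (hU : IsOpen U) :
    IsClosed {z : PointSet G × (G × S.H) | S.cosetProjectionSet z.2 U ⊆ z.1.carrier} := by
  have hclosed : ∀ l : G × S.H, IsClosed {z : PointSet G × (G × S.H) |
      (l + z.2).2 ∈ Uᶜ ∨ (l + z.2).1 ∈ z.1.carrier} := fun l =>
    (hU.isClosed_compl.preimage (f := fun z : PointSet G × (G × S.H) => (l + z.2).2)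
      (by fun_prop)).union (PointSet.isClosed_setOf_mem.preimage
        (f := fun z : PointSet G × (G × S.H) => (z.1, (l + z.2).1)) (by fun_prop))
  convert isClosed_biInter fun l (_ : l ∈ S.lattice) => hclosed l using 1
  ext ⟨Γ, p⟩
  simp only [mem_iInter, mem_ofPred_eq, ← imp_iff_not_or, mem_compl_iff]
  constructor
  · exact fun h l hl hlU => h ⟨(l + p).2, hlU, by rwa [Prod.mk.eta, add_sub_cancel_right]⟩
  · rintro h x ⟨k, hk, hl⟩
    simpa using h _ hl (by simpa using hk)

end Projection

section Hull

variable {G : Type u} [AddCommGroup G] [TopologicalSpace G]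

/-- The set `Γ` lies between the projection sets, for the coset `p + 𝓛`, of the non-empty open
window `U` and the compact window `W ⊇ U`. For `p = 0` this says that `Γ` is an almost model set. -/
structure Brackets (S : CutAndProjectScheme G) (p : G × S.H) (U W : Set S.H) (Γ : Set G) :
    Prop where
  subset : U ⊆ W
  isOpen : IsOpen U
  nonempty : U.Nonempty
  isCompact : IsCompact W
  cosetProjectionSet_subset : S.cosetProjectionSet p U ⊆ Γ
  subset_cosetProjectionSet : Γ ⊆ S.cosetProjectionSet p W

variable {S : CutAndProjectScheme G} {p : G × S.H} {U W : Set S.H}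

theorem Brackets.translate [IsTopologicalAddGroup G] {Λ : PointSet G}
    (h : S.Brackets p U W Λ.carrier) (s : G) :
    S.Brackets (p + (s, 0)) U W (Λ.translate s).carrier where
  __ := h
  cosetProjectionSet_subset :=
    (S.image_add_cosetProjectionSet s p U).ge.trans (image_mono h.cosetProjectionSet_subset)
  subset_cosetProjectionSet :=
    (image_mono h.subset_cosetProjectionSet).trans (S.image_add_cosetProjectionSet s p W).le

theorem Brackets.add_of_mem {Γ : Set G} (h : S.Brackets p U W Γ) {l : G × S.H}
    (hl : l ∈ S.lattice) : S.Brackets (p + l) U W Γ where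
  __ := h
  cosetProjectionSet_subset := cosetProjectionSet_add_of_mem hl p U ▸ h.cosetProjectionSet_subset
  subset_cosetProjectionSet := cosetProjectionSet_add_of_mem hl p W ▸ h.subset_cosetProjectionSet

variable [IsTopologicalAddGroup G] [LocallyCompactSpace G] [T2Space G]

theorem isClosed_setOf_brackets (hUW : U ⊆ W) (hU : IsOpen U) (hne : U.Nonempty)
    (hW : IsCompact W) :
    IsClosed {z : PointSet G × (G × S.H) | S.Brackets z.2 U W z.1.carrier} := by
  convert (S.isClosed_setOf_cosetProjectionSet_subset hU).inter
    (PointSet.isClosed_setOf_forall_mem (S.isClosed_setOf_mem_cosetProjectionSet hW)) using 1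
  ext z
  exact ⟨fun h => ⟨h.cosetProjectionSet_subset, h.subset_cosetProjectionSet⟩,
    fun h => ⟨hUW, hU, hne, hW, h.1, h.2⟩⟩

/-- Modulo the lattice, the admissible cosets form a compact set, so that a limit of translates of
`Λ` has an admissible coset as well. -/
theorem Brackets.exists_of_mem_hull {Λ Γ : PointSet G}
    (h : S.Brackets p U W Λ.carrier) (hΓ : Γ ∈ Λ.hull) : ∃ q, S.Brackets q U W Γ.carrier := by
  have := S.cocompact
  obtain ⟨C, hC, hCl⟩ := exists_isCompact_forall_exists_add_mem S.lattice
  have : CompactSpace C := isCompact_iff_compactSpace.1 hC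
  have hclosed : IsClosed (Prod.fst '' {z : PointSet G × C | S.Brackets z.2 U W z.1.carrier}) :=
    isClosedMap_fst_of_compactSpace _
      ((isClosed_setOf_brackets h.subset h.isOpen h.nonempty h.isCompact).preimage
        (continuous_id.prodMap continuous_subtype_val))
  have horbit : range (fun s => Λ.translate s) ⊆
      Prod.fst '' {z : PointSet G × C | S.Brackets z.2 U W z.1.carrier} := by
    rintro _ ⟨s, rfl⟩
    obtain ⟨l, hl, hlC⟩ := hCl (p + (s, 0))
    exact ⟨(Λ.translate s, ⟨_, hlC⟩), (h.translate s).add_of_mem hl, rfl⟩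
  obtain ⟨⟨_, q⟩, hq, rfl⟩ := closure_minimal horbit hclosed hΓ
  exact ⟨q, hq⟩

end Hull

section Reduction

variable {G X : Type u} [AddCommGroup G] [AddCommGroup X]

/-- The kernel of the first projection on a subgroup `N` of `G × X`, as a subgroup of `X`. It is
the obstruction to injectivity of that projection. -/
def fiber (N : AddSubgroup (G × X)) : AddSubgroup X :=
  N.comap (AddMonoidHom.inr G X)

/-- The image in `G × X ⧸ fiber N` of a subgroup `N` of `G × X`. -/
def reducedLattice (N : AddSubgroup (G × X)) : AddSubgroup (G × X ⧸ fiber N) :=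
  N.map ((AddMonoidHom.id G).prodMap (QuotientAddGroup.mk' (fiber N)))

theorem mk_mem_reducedLattice {N : AddSubgroup (G × X)} {x : G} {h : X} :
    (x, (h : X ⧸ fiber N)) ∈ reducedLattice N ↔ (x, h) ∈ N := by
  refine ⟨?_, fun hN => ⟨(x, h), hN, rfl⟩⟩
  rintro ⟨⟨y, k⟩, hN, heq⟩
  obtain ⟨rfl, hkh⟩ := Prod.mk.inj heq
  have hfib : (0, k - h) ∈ N := QuotientAddGroup.eq_iff_sub_mem.1 hkh
  simpa using N.sub_mem hN hfib

variable [TopologicalSpace G] [TopologicalSpace X] [IsTopologicalAddGroup X]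

theorem discreteTopology_reducedLattice (N : AddSubgroup (G × X)) [DiscreteTopology N] :
    DiscreteTopology (reducedLattice N) := by
  have hmk : IsOpenQuotientMap
      (Prod.map id QuotientAddGroup.mk : G × X → G × X ⧸ fiber N) :=
    IsOpenQuotientMap.id.prodMap QuotientAddGroup.isOpenQuotientMap_mk
  have hpre : Prod.map id QuotientAddGroup.mk ⁻¹' (reducedLattice N : Set (G × X ⧸ fiber N)) =
      (N : Set (G × X)) :=
    Set.ext fun _ => mk_mem_reducedLattice
  have : DiscreteTopology (Prod.map id QuotientAddGroup.mk ⁻¹'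
      (reducedLattice N : Set (G × X ⧸ fiber N))) := by
    rw [hpre]
    infer_instance
  exact discreteTopology_of_isOpenQuotientMap hmk

variable [IsTopologicalAddGroup G] [T2Space G] [T2Space X]

theorem isClosed_fiber (N : AddSubgroup (G × X)) [DiscreteTopology N] :
    IsClosed (fiber N : Set X) :=
  (AddSubgroup.isClosed_of_discrete (H := N)).preimage (by fun_prop : Continuous (Prod.mk (0 : G)))

/-- The cut-and-project scheme with lattice `reducedLattice N`; dividing out `fiber N` makes the
projection to `G` injective. -/
def reduction [LocallyCompactSpace X] (N : AddSubgroup (G × X)) (hdiscrete : DiscreteTopology N)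
    (hcocompact : CompactSpace ((G × X) ⧸ N)) (hdense : Dense (Prod.snd '' (N : Set (G × X)))) :
    CutAndProjectScheme G :=
  have := isClosed_fiber N
  { H := X ⧸ fiber N
    instMeasurableSpace := borel _
    instBorelSpace := @BorelSpace.mk _ _ (borel _) rfl
    lattice := reducedLattice N
    discrete := discreteTopology_reducedLattice N
    cocompact := by
      refine compactSpace_quotient_of_forall_exists_sub_mem (N := N)
        (f := (AddMonoidHom.id G).prodMap (QuotientAddGroup.mk' (fiber N)))
        (continuous_id.prodMap QuotientAddGroup.continuous_mk) (AddSubgroup.le_comap_map _ _) ?_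
      rintro ⟨x, q⟩
      obtain ⟨h, rfl⟩ := QuotientAddGroup.mk_surjective q
      refine ⟨(x, h), ?_⟩
      convert (reducedLattice N).zero_mem
      exact sub_self _
    injOn_fst := by
      rintro ⟨x, q⟩ hq ⟨y, r⟩ hr (rfl : x = y)
      obtain ⟨h, rfl⟩ := QuotientAddGroup.mk_surjective q
      obtain ⟨k, rfl⟩ := QuotientAddGroup.mk_surjective r
      have hsub := N.sub_mem (mk_mem_reducedLattice.1 hq) (mk_mem_reducedLattice.1 hr)
      rw [Prod.mk_sub_mk, sub_self] at hsub
      rw [QuotientAddGroup.eq_iff_sub_mem.2 hsub]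
    dense_snd := by
      convert QuotientAddGroup.mk_surjective.denseRange.dense_image
        (QuotientAddGroup.continuous_mk (N := fiber N)) hdense using 1
      simp only [reducedLattice, AddSubgroup.coe_map, image_image]
      rfl }

end Reduction

section Adjoin

variable {G : Type u} [AddCommGroup G] [TopologicalSpace G]

/-- The subgroup of `G × (H × ℤ)` whose points over `n : ℤ` are those of the coset `n • p + 𝓛`. -/
def adjoinLattice (S : CutAndProjectScheme G) (p : G × S.H) : AddSubgroup (G × (S.H × ℤ)) :=
  S.lattice.comap (AddMonoidHom.mk' (fun z => (z.1, z.2.1) - z.2.2 • p) fun y z => by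
    ext <;> simp [add_smul] <;> abel)

theorem mem_adjoinLattice {S : CutAndProjectScheme G} {p : G × S.H} {x : G} {h : S.H} {n : ℤ} :
    (x, (h, n)) ∈ S.adjoinLattice p ↔ (x, h) - n • p ∈ S.lattice :=
  Iff.rfl

theorem mk_zero_mem_adjoinLattice {S : CutAndProjectScheme G} {p : G × S.H} {x : G} {h : S.H} :
    (x, (h, 0)) ∈ S.adjoinLattice p ↔ (x, h) ∈ S.lattice := by
  rw [mem_adjoinLattice, zero_smul, sub_zero]

variable (S : CutAndProjectScheme G) (p : G × S.H)

theorem compactSpace_quotient_adjoinLattice :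
    CompactSpace ((G × (S.H × ℤ)) ⧸ S.adjoinLattice p) := by
  have := S.cocompact
  refine compactSpace_quotient_of_forall_exists_sub_mem (N := S.lattice)
    (f := (AddMonoidHom.id G).prodMap (AddMonoidHom.inl S.H ℤ))
    (continuous_id.prodMap (by fun_prop : Continuous fun h : S.H => (h, (0 : ℤ))))
    (fun _ hl => mk_zero_mem_adjoinLattice.2 hl) ?_
  rintro ⟨x, h, n⟩
  have hp : (n • p.1, (n • p.2, n)) ∈ S.adjoinLattice p := by
    rw [mem_adjoinLattice]
    convert S.lattice.zero_mem
    exact sub_self _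
  refine ⟨(x, h) - n • p, ?_⟩
  convert (S.adjoinLattice p).neg_mem hp using 1
  ext <;> simp

theorem dense_snd_adjoinLattice :
    Dense (Prod.snd '' (S.adjoinLattice p : Set (G × (S.H × ℤ)))) := by
  rintro ⟨h, n⟩
  have hmaps : MapsTo (fun k : S.H => (k + n • p.2, n)) (Prod.snd '' (S.lattice : Set (G × S.H)))
      (Prod.snd '' (S.adjoinLattice p : Set (G × (S.H × ℤ)))) := by
    rintro _ ⟨l, hl, rfl⟩
    refine ⟨(l.1 + n • p.1, (l.2 + n • p.2, n)), ?_, rfl⟩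
    rw [SetLike.mem_coe, mem_adjoinLattice]
    simpa [Prod.smul_def] using hl
  simpa using map_mem_closure (by fun_prop) (S.dense_snd (h - n • p.2)) hmaps

variable [IsTopologicalAddGroup G]

theorem discreteTopology_adjoinLattice : DiscreteTopology (S.adjoinLattice p) := by
  have := S.discrete
  let f : S.adjoinLattice p → S.lattice × ℤ := fun z =>
    (⟨(z.1.1, z.1.2.1) - z.1.2.2 • p, z.2⟩, z.1.2.2)
  refine DiscreteTopology.of_continuous_injective (f := f) ?_ ?_
  · have : Continuous fun n : ℤ => n • p := continuous_of_discreteTopology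
    fun_prop
  · rintro ⟨⟨x, h, n⟩, hz⟩ ⟨⟨y, k, m⟩, hw⟩ heq
    simp only [f, Prod.mk.injEq] at heq
    obtain ⟨hxy, rfl⟩ := heq
    obtain ⟨rfl, rfl⟩ := Prod.mk.inj (sub_left_injective (congrArg Subtype.val hxy))
    rfl

variable [T2Space G]

/-- The cut-and-project scheme in which the coset `p + 𝓛` becomes part of the lattice. Its internal
space is the quotient of `H × ℤ` by the pairs `(h, n)` with `(0, h) ∈ n • p + 𝓛`. -/
def adjoin : CutAndProjectScheme G :=
  reduction (S.adjoinLattice p) (S.discreteTopology_adjoinLattice p)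
    (S.compactSpace_quotient_adjoinLattice p) (S.dense_snd_adjoinLattice p)

/-- The quotient map onto the internal space of the scheme with `p + 𝓛` adjoined. -/
def adjoinMk : S.H × ℤ →+ (S.adjoin p).H :=
  QuotientAddGroup.mk' (fiber (S.adjoinLattice p))

theorem isOpenQuotientMap_adjoinMk : IsOpenQuotientMap (S.adjoinMk p) :=
  QuotientAddGroup.isOpenQuotientMap_mk

theorem adjoinMk_mem_lattice {x : G} {h : S.H} {n : ℤ} :
    (x, S.adjoinMk p (h, n)) ∈ (S.adjoin p).lattice ↔ (x, h) - n • p ∈ S.lattice :=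
  mk_mem_reducedLattice

/-- The inclusion of the internal space of `S` into that of `S.adjoin p`, as an open subgroup. -/
def adjoinHom : S.H →+ (S.adjoin p).H :=
  (S.adjoinMk p).comp (AddMonoidHom.inl S.H ℤ)

/-- The identification of the internal space of `S` with the coset of the open subgroup
`range (S.adjoinHom p)` that contains the internal coordinates of `p + 𝓛`. -/
def adjoinMap (h : S.H) : (S.adjoin p).H :=
  S.adjoinMk p (h, 1)

theorem isOpenEmbedding_adjoinHom : IsOpenEmbedding (S.adjoinHom p) := by
  refine .of_continuous_injective_isOpenMap ?_ ?_ ?_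
  · exact (S.isOpenQuotientMap_adjoinMk p).continuous.comp
      (by fun_prop : Continuous fun h : S.H => (h, (0 : ℤ)))
  · refine (injective_iff_map_eq_zero _).2 fun h hh => ?_
    have hl : (0, S.adjoinMk p (h, 0)) ∈ (S.adjoin p).lattice :=
      hh ▸ (S.adjoin p).lattice.zero_mem
    rw [adjoinMk_mem_lattice, zero_smul, sub_zero] at hl
    exact congrArg Prod.snd (S.injOn_fst hl S.lattice.zero_mem rfl)
  · refine (S.isOpenQuotientMap_adjoinMk p).isOpenMap.comp fun U hU => ?_
    convert hU.prod (isOpen_discrete ({0} : Set ℤ)) using 1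
    exact prod_singleton.symm

theorem adjoinMap_eq_add : S.adjoinMap p = (S.adjoinMk p (0, 1) + ·) ∘ S.adjoinHom p := by
  ext h
  simpa [adjoinMap, adjoinHom] using map_add (S.adjoinMk p) (0, 1) (h, 0)

theorem isOpenEmbedding_adjoinMap : IsOpenEmbedding (S.adjoinMap p) := by
  rw [adjoinMap_eq_add]
  exact (Homeomorph.addLeft (S.adjoinMk p (0, 1))).isOpenEmbedding.comp
    (S.isOpenEmbedding_adjoinHom p)

theorem projectionSet_adjoinMap (W : Set S.H) :
    (S.adjoin p).projectionSet (S.adjoinMap p '' W) = S.cosetProjectionSet p W := by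
  ext x
  simp only [mem_projectionSet, exists_mem_image, adjoinMap, adjoinMk_mem_lattice, one_smul]
  rfl

theorem addHaar_adjoinMap_image_eq_zero {A : Set S.H} (hA : IsCompact A)
    (h0 : (Measure.addHaar : Measure S.H) A = 0) :
    (Measure.addHaar : Measure (S.adjoin p).H) (S.adjoinMap p '' A) = 0 := by
  rw [adjoinMap_eq_add, image_comp, image_add_left, measure_preimage_add]
  exact addHaar_image_eq_zero_of_isOpenEmbedding (S.isOpenEmbedding_adjoinHom p) hA h0

variable {S p} in
theorem Brackets.adjoin {U W : Set S.H} {Γ : Set G} (h : S.Brackets p U W Γ) :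
    (S.adjoin p).Brackets 0 (S.adjoinMap p '' U) (S.adjoinMap p '' W) Γ where
  subset := image_mono h.subset
  isOpen := (S.isOpenEmbedding_adjoinMap p).isOpenMap U h.isOpen
  nonempty := h.nonempty.image _
  isCompact := h.isCompact.image (S.isOpenEmbedding_adjoinMap p).continuous
  cosetProjectionSet_subset := by
    rw [cosetProjectionSet_zero, projectionSet_adjoinMap]
    exact h.cosetProjectionSet_subset
  subset_cosetProjectionSet := by
    rw [cosetProjectionSet_zero, projectionSet_adjoinMap]
    exact h.subset_cosetProjectionSet

end Adjoin

section Refinement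

variable {G : Type u} [AddCommGroup G] [TopologicalSpace G] {K : Type u} [AddCommGroup K]
  [TopologicalSpace K] [IsTopologicalAddGroup K] (S : CutAndProjectScheme G) (φ : S.lattice →+ K)

/-- The closure in `H × K` of the image of the lattice under the star map paired with `φ`. -/
abbrev refinedSpace : AddSubgroup (S.H × K) :=
  (((AddMonoidHom.snd G S.H).comp S.lattice.subtype).prod φ).range.topologicalClosure

/-- The star map paired with `φ`, as a map to the closure of its range. -/
def refinedStar : S.lattice →+ S.refinedSpace φ :=
  (((AddMonoidHom.snd G S.H).comp S.lattice.subtype).prod φ).codRestrict _ fun l =>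
    AddSubgroup.le_topologicalClosure _ ⟨l, rfl⟩

/-- The lattice lifted to `G × S.refinedSpace φ`. -/
def refinedLattice : AddSubgroup (G × S.refinedSpace φ) :=
  (((AddMonoidHom.fst G S.H).comp S.lattice.subtype).prod (S.refinedStar φ)).range

/-- The projection from the refined to the original internal space. -/
def refinedFst : S.refinedSpace φ →+ S.H :=
  (AddMonoidHom.fst S.H K).comp (S.refinedSpace φ).subtype

theorem continuous_refinedFst : Continuous (S.refinedFst φ) :=
  continuous_fst.comp continuous_subtype_val

theorem mem_refinedLattice {x : G} {k : S.refinedSpace φ} :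
    (x, k) ∈ S.refinedLattice φ ↔
      ∃ hl : (x, S.refinedFst φ k) ∈ S.lattice, k = S.refinedStar φ ⟨_, hl⟩ := by
  constructor
  · rintro ⟨l, hl⟩
    obtain ⟨rfl, rfl⟩ := Prod.mk.inj hl
    exact ⟨l.2, rfl⟩
  · rintro ⟨hl, hk⟩
    exact ⟨⟨_, hl⟩, Prod.ext rfl hk.symm⟩

theorem isClosedEmbedding_refinedSpace_val :
    IsClosedEmbedding (Subtype.val : S.refinedSpace φ → S.H × K) :=
  (AddSubgroup.isClosed_topologicalClosure _).isClosedEmbedding_subtypeVal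

theorem discreteTopology_refinedLattice : DiscreteTopology (S.refinedLattice φ) := by
  have := S.discrete
  let f : S.refinedLattice φ → S.lattice := fun z =>
    ⟨(z.1.1, S.refinedFst φ z.1.2), ((S.mem_refinedLattice φ).1 z.2).1⟩
  refine DiscreteTopology.of_continuous_injective (f := f) ?_ ?_
  · have := S.continuous_refinedFst φ
    fun_prop
  · rintro ⟨_, l, rfl⟩ ⟨_, l', rfl⟩ h
    have : l = l' := h
    rw [this]

theorem dense_snd_refinedLattice :
    Dense (Prod.snd '' (S.refinedLattice φ : Set (G × S.refinedSpace φ))) := by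
  have hdense : DenseRange (S.refinedStar φ) := fun x => by
    rw [closure_subtype, ← range_comp]
    exact x.2
  refine hdense.mono ?_
  rintro _ ⟨l, rfl⟩
  exact ⟨_, ⟨l, rfl⟩, rfl⟩

variable [CompactSpace K]

theorem isProperMap_refinedFst : IsProperMap (S.refinedFst φ) :=
  isProperMap_fst_of_compactSpace.comp (S.isClosedEmbedding_refinedSpace_val φ).isProperMap

theorem surjective_refinedFst : Function.Surjective (S.refinedFst φ) := by
  rw [← range_eq_univ, ← (S.isProperMap_refinedFst φ).isClosedMap.isClosed_range.closure_eq]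
  refine (S.dense_snd.mono ?_).closure_eq
  rintro _ ⟨l, hl, rfl⟩
  exact ⟨S.refinedStar φ ⟨l, hl⟩, rfl⟩

variable [IsTopologicalAddGroup G] [LocallyCompactSpace G]

theorem compactSpace_quotient_refinedLattice :
    CompactSpace ((G × S.refinedSpace φ) ⧸ S.refinedLattice φ) := by
  have := S.cocompact
  refine compactSpace_quotient_of_isProperMap (N := S.lattice)
    (f := (AddMonoidHom.id G).prodMap (S.refinedFst φ))
    (isProperMap_id.prodMap (S.isProperMap_refinedFst φ)) fun l hl => ?_
  exact ⟨_, ⟨⟨l, hl⟩, rfl⟩, rfl⟩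

variable [T2Space K]

/-- The cut-and-project scheme in which the star map is replaced by its pair with `φ`. -/
def refinement : CutAndProjectScheme G where
  H := S.refinedSpace φ
  instLocallyCompactSpace := (S.isClosedEmbedding_refinedSpace_val φ).locallyCompactSpace
  instMeasurableSpace := borel _
  instBorelSpace := @BorelSpace.mk _ _ (borel _) rfl
  lattice := S.refinedLattice φ
  discrete := S.discreteTopology_refinedLattice φ
  cocompact := S.compactSpace_quotient_refinedLattice φ
  injOn_fst := by
    rintro _ ⟨l, rfl⟩ _ ⟨l', rfl⟩ h
    rw [Subtype.ext (S.injOn_fst l.2 l'.2 h)]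
  dense_snd := S.dense_snd_refinedLattice φ

/-- The projection `S.refinedFst φ`, with the internal space of the refinement as its domain. -/
def refinementFst : (S.refinement φ).H →+ S.H :=
  S.refinedFst φ

theorem isProperMap_refinementFst : IsProperMap (S.refinementFst φ) :=
  S.isProperMap_refinedFst φ

theorem addHaar_refinementFst_preimage_eq_zero {A : Set S.H} (hA : IsCompact A)
    (h0 : (Measure.addHaar : Measure S.H) A = 0) :
    (Measure.addHaar : Measure (S.refinement φ).H) (S.refinementFst φ ⁻¹' A) = 0 :=
  addHaar_preimage_eq_zero_of_isProperMap (S.isProperMap_refinementFst φ)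
    (S.surjective_refinedFst φ) hA h0

variable {S} {U W : Set S.H} {Γ : Set G}

/-- The window is `U` together with the part of `W` cut out by `B`: over `W \ U` the `K`-coordinate
decides which lattice points belong to `Γ`. -/
theorem Brackets.exists_projectionSet_refinement_eq (h : S.Brackets 0 U W Γ)
    {B : Set K} (hB : MeasurableSet[borel K] B) (hBΓ : φ ⁻¹' B = {l : S.lattice | l.1.1 ∈ Γ}) :
    ∃ V : Set (S.refinement φ).H, MeasurableSet V ∧ S.refinementFst φ ⁻¹' U ⊆ V ∧
      V ⊆ S.refinementFst φ ⁻¹' W ∧ Γ = (S.refinement φ).projectionSet V := by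
  obtain ⟨hUW, hU, -, hW, hUΓ, hΓW⟩ := h
  rw [cosetProjectionSet_zero] at hUΓ hΓW
  let κ : (S.refinement φ).H → K := fun k => (k : S.refinedSpace φ).1.2
  have hπ : Continuous (S.refinementFst φ) := S.continuous_refinedFst φ
  have hκ : Continuous κ := continuous_snd.comp continuous_subtype_val
  have hmem : ∀ l, κ (S.refinedStar φ l) ∈ B ↔ l.1.1 ∈ Γ := Set.ext_iff.1 hBΓ
  refine ⟨S.refinementFst φ ⁻¹' U ∪ (S.refinementFst φ ⁻¹' W ∩ κ ⁻¹' B), ?_, subset_union_left,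
    union_subset (preimage_mono hUW) inter_subset_left, ?_⟩
  · exact (hU.preimage hπ).measurableSet.union
      ((hW.isClosed.preimage hπ).measurableSet.inter (measurableSet_preimage_borel hκ hB))
  ext x
  rw [mem_projectionSet]
  constructor
  · intro hx
    obtain ⟨h, hhW, hl⟩ := mem_projectionSet.1 (hΓW hx)
    exact ⟨S.refinedStar φ ⟨(x, h), hl⟩, Or.inr ⟨hhW, (hmem ⟨(x, h), hl⟩).2 hx⟩,
      ⟨(x, h), hl⟩, rfl⟩
  · rintro ⟨_, hV, l, hl⟩
    obtain ⟨rfl, rfl⟩ := Prod.mk.inj hl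
    rcases hV with hV | ⟨-, hV⟩
    · exact hUΓ (mem_projectionSet.2 ⟨_, hV, l.2⟩)
    · exact (hmem l).1 hV

theorem isModelWindow_refinement_of_subset (hU : IsOpen U) (hne : U.Nonempty) (hW : IsCompact W)
    {V : Set (S.refinement φ).H} (hV : MeasurableSet V) (hUV : S.refinementFst φ ⁻¹' U ⊆ V)
    (hVW : V ⊆ S.refinementFst φ ⁻¹' W) :
    (S.refinement φ).IsModelWindow V ∧ frontier V ⊆ S.refinementFst φ ⁻¹' (W \ U) := by
  have hWc : IsCompact (X := (S.refinement φ).H) (S.refinementFst φ ⁻¹' W) :=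
    (S.isProperMap_refinementFst φ).isCompact_preimage hW
  have hint : S.refinementFst φ ⁻¹' U ⊆ interior V :=
    interior_maximal hUV (hU.preimage (S.continuous_refinedFst φ))
  have hcl : closure V ⊆ S.refinementFst φ ⁻¹' W := closure_minimal hVW hWc.isClosed
  exact ⟨⟨hWc.of_isClosed_subset isClosed_closure hcl, hV,
    (hne.preimage (S.surjective_refinedFst φ)).mono hint⟩,
    fun x hx => ⟨hcl hx.1, fun hxU => hx.2 (hint hxU)⟩⟩

theorem Brackets.exists_isModelWindow (h : S.Brackets 0 U W Γ) :
    ∃ (T : CutAndProjectScheme G) (V : Set T.H), T.IsModelWindow V ∧ Γ = T.projectionSet V ∧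
      ((Measure.addHaar : Measure S.H) (W \ U) = 0 →
        (Measure.addHaar : Measure T.H) (frontier V) = 0) := by
  obtain ⟨E, φ, hφ⟩ := exists_addMonoidHom_forall_exists_borel_preimage_eq S.lattice
  obtain ⟨B, hB, hBΓ⟩ := hφ {l : S.lattice | l.1.1 ∈ Γ}
  obtain ⟨V, hVm, hUV, hVW, hΓ⟩ := h.exists_projectionSet_refinement_eq φ hB hBΓ
  obtain ⟨hV, hfr⟩ :=
    isModelWindow_refinement_of_subset φ h.isOpen h.nonempty h.isCompact hVm hUV hVW
  exact ⟨S.refinement φ, V, hV, hΓ, fun h0 => measure_mono_null hfr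
    (S.addHaar_refinementFst_preimage_eq_zero φ (h.isCompact.diff h.isOpen) h0)⟩

end Refinement

end CutAndProjectScheme

section Comparison

variable {G : Type u} [AddCommGroup G] [TopologicalSpace G] {Γ : Set G}

theorem IsModelSet.isInterModelSet (h : IsModelSet Γ) : IsInterModelSet Γ := by
  obtain ⟨S, W, hW, rfl⟩ := h
  exact ⟨S, W, hW, S.projectionSet_mono interior_subset, S.projectionSet_mono subset_closure⟩

theorem IsRegularModelSet.isInterRegularModelSet (h : IsRegularModelSet Γ) :
    IsInterRegularModelSet Γ := by
  obtain ⟨S, W, hW, rfl⟩ := h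
  exact ⟨S, W, hW, S.projectionSet_mono interior_subset, S.projectionSet_mono subset_closure⟩

theorem IsInterModelSet.isAlmostModelSet (h : IsInterModelSet Γ) : IsAlmostModelSet Γ := by
  obtain ⟨S, W, hW, hlower, hupper⟩ := h
  exact ⟨S, interior W, closure W, interior_subset.trans subset_closure, isOpen_interior,
    hW.nonempty_interior, hW.isCompact_closure, hlower, hupper⟩

theorem IsInterRegularModelSet.isAlmostRegularModelSet (h : IsInterRegularModelSet Γ) :
    IsAlmostRegularModelSet Γ := by
  obtain ⟨S, W, hW, hlower, hupper⟩ := h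
  exact ⟨S, interior W, closure W, interior_subset.trans subset_closure, isOpen_interior,
    hW.nonempty_interior, hW.isCompact_closure, hW.haar_frontier, hlower, hupper⟩

theorem isAlmostModelSet_iff_exists_brackets :
    IsAlmostModelSet Γ ↔
      ∃ (S : CutAndProjectScheme G) (U W : Set S.H), S.Brackets 0 U W Γ := by
  refine exists_congr fun S => exists₂_congr fun U W => ?_
  constructor
  · rintro ⟨hUW, hU, hne, hW, hlower, hupper⟩
    rw [← S.cosetProjectionSet_zero] at hlower hupper
    exact ⟨hUW, hU, hne, hW, hlower, hupper⟩
  · rintro ⟨hUW, hU, hne, hW, hlower, hupper⟩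
    rw [S.cosetProjectionSet_zero] at hlower hupper
    exact ⟨hUW, hU, hne, hW, hlower, hupper⟩

theorem isAlmostRegularModelSet_iff_exists_brackets :
    IsAlmostRegularModelSet Γ ↔
      ∃ (S : CutAndProjectScheme G) (U W : Set S.H), S.Brackets 0 U W Γ ∧
        (Measure.addHaar : Measure S.H) (W \ U) = 0 := by
  refine exists_congr fun S => exists₂_congr fun U W => ?_
  constructor
  · rintro ⟨hUW, hU, hne, hW, h0, hlower, hupper⟩
    rw [← S.cosetProjectionSet_zero] at hlower hupper
    exact ⟨⟨hUW, hU, hne, hW, hlower, hupper⟩, h0⟩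
  · rintro ⟨⟨hUW, hU, hne, hW, hlower, hupper⟩, h0⟩
    rw [S.cosetProjectionSet_zero] at hlower hupper
    exact ⟨hUW, hU, hne, hW, h0, hlower, hupper⟩

variable [IsTopologicalAddGroup G] [LocallyCompactSpace G]

theorem IsAlmostModelSet.isModelSet (h : IsAlmostModelSet Γ) : IsModelSet Γ := by
  obtain ⟨S, U, W, hΓ⟩ := isAlmostModelSet_iff_exists_brackets.1 h
  obtain ⟨T, V, hV, hΓV, -⟩ := hΓ.exists_isModelWindow
  exact ⟨T, V, hV, hΓV⟩

theorem IsAlmostRegularModelSet.isRegularModelSet (h : IsAlmostRegularModelSet Γ) :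
    IsRegularModelSet Γ := by
  obtain ⟨S, U, W, hΓ, h0⟩ := isAlmostRegularModelSet_iff_exists_brackets.1 h
  obtain ⟨T, V, hV, hΓV, hfr⟩ := hΓ.exists_isModelWindow
  exact ⟨T, V, ⟨hV, hfr h0⟩, hΓV⟩

variable [T2Space G] {Λ Δ : PointSet G}

theorem IsAlmostModelSet.of_mem_hull (h : IsAlmostModelSet Λ.carrier) (hΔ : Δ ∈ Λ.hull) :
    IsAlmostModelSet Δ.carrier := by
  obtain ⟨S, U, W, hΛ⟩ := isAlmostModelSet_iff_exists_brackets.1 h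
  obtain ⟨q, hq⟩ := hΛ.exists_of_mem_hull hΔ
  exact isAlmostModelSet_iff_exists_brackets.2 ⟨S.adjoin q, _, _, hq.adjoin⟩

theorem IsAlmostRegularModelSet.of_mem_hull (h : IsAlmostRegularModelSet Λ.carrier)
    (hΔ : Δ ∈ Λ.hull) : IsAlmostRegularModelSet Δ.carrier := by
  obtain ⟨S, U, W, hΛ, h0⟩ := isAlmostRegularModelSet_iff_exists_brackets.1 h
  obtain ⟨q, hq⟩ := hΛ.exists_of_mem_hull hΔ
  refine isAlmostRegularModelSet_iff_exists_brackets.2 ⟨S.adjoin q, _, _, hq.adjoin, ?_⟩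
  rw [← image_sdiff (S.isOpenEmbedding_adjoinMap q).injective]
  exact S.addHaar_adjoinMap_image_eq_zero q (hq.isCompact.diff hq.isOpen) h0

end Comparison

theorem mainTheorem5 {G : Type u} [AddCommGroup G] [TopologicalSpace G]
    [IsTopologicalAddGroup G] [LocallyCompactSpace G] [T2Space G]
    (Λ Γ : PointSet G) (hΓ : Γ ∈ Λ.hull) :
    ((IsModelSet Λ.carrier → IsModelSet Γ.carrier) ∧
      (IsRegularModelSet Λ.carrier → IsRegularModelSet Γ.carrier)) ∧
    ((IsInterModelSet Λ.carrier → IsInterModelSet Γ.carrier) ∧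
      (IsInterRegularModelSet Λ.carrier → IsInterRegularModelSet Γ.carrier)) ∧
    ((IsAlmostModelSet Λ.carrier → IsAlmostModelSet Γ.carrier) ∧
      (IsAlmostRegularModelSet Λ.carrier → IsAlmostRegularModelSet Γ.carrier)) := by
  refine ⟨⟨fun h => ?_, fun h => ?_⟩, ⟨fun h => ?_, fun h => ?_⟩, fun h => h.of_mem_hull hΓ,
    fun h => h.of_mem_hull hΓ⟩
  · exact (h.isInterModelSet.isAlmostModelSet.of_mem_hull hΓ).isModelSet
  · exact (h.isInterRegularModelSet.isAlmostRegularModelSet.of_mem_hull hΓ).isRegularModelSet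
  · exact (h.isAlmostModelSet.of_mem_hull hΓ).isModelSet.isInterModelSet
  · exact (h.isAlmostRegularModelSet.of_mem_hull hΓ).isRegularModelSet.isInterRegularModelSet
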